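/- Let $n\ge 1$ and let $s=(s_\alpha)_{\alpha\in\mathbb N_0^n}$ be a real sequence. Let $L_s:\mathbb R[x_1,\dots,x_n]\to\mathbb R$ be the linear functional with $L_s(x^\alpha)=s_\alpha$, and let $\partial_1\cdots\partial_n s$ be the sequence with entries $(\partial_1\cdots\partial_n s)_\alpha=(-1)^n L_s(\partial_1\cdots\partial_n x^\alpha)$. Then the following are equivalent: (i) There exists an integrable, almost everywhere continuous function $f:[0,1]^n\to\mathbb R$ such that $s_\alpha=\int_{[0,1]^n}x^\alpha f(x)\,\mathrm dx$ for all $\alpha\in\mathbb N_0^n$ and such that $\partial_1\cdots\partial_n f$ is a regular (finite) signed Borel measure on $[0,1]^n$; here the derivative is the distributional derivative on $\mathbb R^n$ of $f$ extended by $0$ outside $[0,1]^n$, i.e. there are finite regular positive Borel measures $\mu_1,\mu_2$ on $[0,1]^n$ with $(-1)^n\int_{[0,1]^n} f\,\partial_1\cdots\partial_n\varphi\,\mathrm dx=\int\varphi\,\mathrm d\mu_1-\int\varphi\,\mathrm d\mu_2$ for all $\varphi\in C_c^\infty(\mathbb R^n)$. (ii) There exists a constant $C>0$ such that for all $d_1,\dots,d_n\in\mathbb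 N_0$ both \[\sum_{k_1=0}^{d_1}\cdots\sum_{k_n=0}^{d_n}\binom{d_1}{k_1}\cdots\binom{d_n}{k_n}\,\Big|L_{s}\Big(\prod_{i=1}^n x_i^{k_i}(1-x_i)^{d_i-k_i}\Big)\Big|<C\] and \[\sum_{k_1=0}^{d_1}\cdots\sum_{k_n=0}^{d_n}\binom{d_1}{k_1}\cdots\binom{d_n}{k_n}\,\Big|L_{\partial_1\cdots\partial_n s}\Big(\prod_{i=1}^n x_i^{k_i}(1-x_i)^{d_i-k_i}\Big)\Big|<C .\] Suppose additionally that $L_s\big(\prod_{i=1}^n x_i^{k_i}(1-x_i)^{l_i}\big)\ge 0$ for all $k_1,\dots,k_n,l_1,\dots,l_n\in\mathbb N_0$. Then every $f$ as in (i) satisfies $f\ge 0$ almost everywhere on $[0,1]^n$ and at every point of $[0,1]^n$ at which $f$ is continuous; and if (i) holds, then $f$ in (i) can be chosen such that $f\ge 0$ everywhere on $[0,1]^n$. -/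

import Mathlib

open MeasureTheory
open scoped Distributions LineDeriv

noncomputable section

namespace CubeMoment

/-- The unit cube `[0,1]^n` in `ℝ^n`. -/
def unitCube (n : ℕ) : Set (Fin n → ℝ) := Set.Icc 0 1

/-- The functional `L_s : ℝ[x_1,…,x_n] → ℝ` of a real multi-sequence `s`, i.e. the linear map
with `L_s(x^α) = s_α`. -/
def rieszFunctional {n : ℕ} (s : (Fin n →₀ ℕ) → ℝ) : MvPolynomial (Fin n) ℝ →ₗ[ℝ] ℝ :=
  (MvPolynomial.basisMonomials (Fin n) ℝ).constr ℝ s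

/-- The mixed partial derivative `∂_1 ⋯ ∂_n p` of a polynomial. -/
def mixedPartial {n : ℕ} (p : MvPolynomial (Fin n) ℝ) : MvPolynomial (Fin n) ℝ :=
  (List.finRange n).foldr (fun i q => MvPolynomial.pderiv i q) p

/-- The derivative `∂_1 ⋯ ∂_n s` of a multi-sequence, `(∂_1 ⋯ ∂_n s)_α = (-1)^n L_s(∂_1 ⋯ ∂_n x^α)`. -/
def mixedDerivSeq {n : ℕ} (s : (Fin n →₀ ℕ) → ℝ) : (Fin n →₀ ℕ) → ℝ :=
  fun α => (-1) ^ n * rieszFunctional s (mixedPartial (MvPolynomial.monomial α 1))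

/-- The polynomial `x_1^{k_1} ⋯ x_n^{k_n} (1 - x_1)^{l_1} ⋯ (1 - x_n)^{l_n}`. -/
def bernsteinProd {n : ℕ} (k l : Fin n → ℕ) : MvPolynomial (Fin n) ℝ :=
  (∏ i, MvPolynomial.X i ^ k i) * ∏ i, (1 - MvPolynomial.X i) ^ l i

/-- The multivariate Bernstein sum
`∑_{k_1 ≤ d_1} ⋯ ∑_{k_n ≤ d_n} ∏_i (d_i choose k_i) |L_s(∏_i x_i^{k_i} (1 - x_i)^{d_i - k_i})|`. -/
def bernsteinSum {n : ℕ} (s : (Fin n →₀ ℕ) → ℝ) (d : Fin n → ℕ) : ℝ :=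
  ∑ k ∈ Fintype.piFinset (fun i => Finset.range (d i + 1)),
    (∏ i, ((d i).choose (k i) : ℝ)) *
      |rieszFunctional s (bernsteinProd k (fun i => d i - k i))|

/-- The distribution `∂_1 ⋯ ∂_n f` on `ℝ^n`, where `f` is extended by zero outside `[0,1]^n`, is a
regular signed measure `μ₁ - μ₂` on `[0,1]^n`. Here `∂^{e} φ` is the mixed partial derivative
`∂_1 ⋯ ∂_n φ` of the test function `φ`. -/
def MixedDerivIsSignedMeasure {n : ℕ} (f : (Fin n → ℝ) → ℝ) : Prop :=
  ∃ μ₁ μ₂ : Measure (Fin n → ℝ),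
    IsFiniteMeasure μ₁ ∧ IsFiniteMeasure μ₂ ∧ μ₁.Regular ∧ μ₂.Regular ∧
    μ₁ (unitCube n)ᶜ = 0 ∧ μ₂ (unitCube n)ᶜ = 0 ∧
    ∀ φ : 𝓓((⊤ : TopologicalSpace.Opens (Fin n → ℝ)), ℝ),
      (-1) ^ n * ∫ x in unitCube n, f x * (∂^{fun i : Fin n => (Pi.single i 1 : Fin n → ℝ)} φ) x =
        (∫ x, φ x ∂μ₁) - ∫ x, φ x ∂μ₂

/-- `f : [0,1]^n → ℝ` is an integrable, almost everywhere continuous function with moments `s`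
whose distributional derivative `∂_1 ⋯ ∂_n f` is a regular signed measure. Only the values of `f`
on the cube matter. -/
structure IsRegularDensity {n : ℕ} (s : (Fin n →₀ ℕ) → ℝ) (f : (Fin n → ℝ) → ℝ) : Prop where
  ae_continuous : ∀ᵐ x ∂(volume.restrict (unitCube n)), ContinuousWithinAt f (unitCube n) x
  integrableOn : IntegrableOn f (unitCube n)
  moments : ∀ α : Fin n →₀ ℕ, s α = ∫ x in unitCube n, (∏ i, x i ^ α i) * f x
  mixedDeriv : MixedDerivIsSignedMeasure f

end CubeMoment

end

/-!
A linear functional on polynomials is integration against a signed measure on the cube exactly when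
its Bernstein sums are bounded: a bound gives discrete measures on the grids `(k / N)_k` with
bounded mass, and a weak limit of these represents the functional. If `s` has density `f`, this
applies to `L_s` with `f dx` and to `L_{∂s}` with the distribution `∂_1 ⋯ ∂_n f`, which proves
(i) ⇒ (ii).

Conversely, the bound for `∂_1 ⋯ ∂_n s` yields a representing signed measure `μ`, and the density is
its distribution function `F y = μ {a | a ≤ y}`. By Fubini, `∫ F ∂_1 ⋯ ∂_n g` is the integral
against `μ` of the alternating sum of `g` over the vertices of `[a, 1]`. It is therefore continuous
in `g` for uniform convergence on the cube, so the distributional derivative of `F` need only be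
tested on polynomials. For the moments, take `g` with `∂_1 ⋯ ∂_n g = x^α` and `g = 0` on the upper
faces, where only the vertex `a` contributes.

If `L_s` is nonnegative on the Bernstein products, it is represented by a positive measure, which
equals `f dx` by moment determinacy, so `f ≥ 0` almost everywhere.
-/

namespace CubeMoment

open Filter MvPolynomial Set
open scoped ContDiff ENNReal NNReal Topology

/-! ### Mixed partial derivatives -/

section MixedDeriv

theorem iteratedFDeriv_succ_apply_eq_fderiv {E F : Type*} [NormedAddCommGroup E] [NormedSpace ℝ E]
    [NormedAddCommGroup F] [NormedSpace ℝ F] {k : ℕ} {g : E → F} (hg : ContDiff ℝ (k + 1) g)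
    (x : E) (m : Fin (k + 1) → E) :
    iteratedFDeriv ℝ (k + 1) g x m =
      fderiv ℝ (fun y => iteratedFDeriv ℝ k g y (Fin.tail m)) x (m 0) := by
  rw [iteratedFDeriv_succ_apply_left, fderiv_continuousMultilinear_apply_const_apply]
  exact hg.differentiable_iteratedFDeriv (by exact_mod_cast k.lt_succ_self) x

theorem iteratedLineDerivOp_eq_iteratedFDeriv {E : Type*} [NormedAddCommGroup E] [NormedSpace ℝ E]
    (φ : 𝓓((⊤ : TopologicalSpace.Opens E), ℝ)) {k : ℕ} (m : Fin k → E) :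
    ⇑(∂^{m} φ) = fun x => iteratedFDeriv ℝ k φ x m := by
  induction k with
  | zero => rfl
  | succ k ih =>
    ext x
    rw [LineDeriv.iteratedLineDerivOp_succ_left, TestFunction.lineDerivOp_eq_lineDerivCLM (𝕜 := ℝ),
      TestFunction.lineDerivCLM_apply_of_le (by simp), DifferentiableAt.lineDeriv_eq_fderiv, ih,
      iteratedFDeriv_succ_apply_eq_fderiv (φ.contDiff.of_le (by exact_mod_cast le_top))]
    exact (∂^{Fin.tail m} φ).contDiff.differentiable (by simp) x

variable {n : ℕ}

/-- The mixed partial derivative `∂_1 ⋯ ∂_n g` of a function on `ℝ^n`. -/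
noncomputable def mixedDeriv (g : (Fin n → ℝ) → ℝ) (x : Fin n → ℝ) : ℝ :=
  iteratedFDeriv ℝ n g x fun i => Pi.single i 1

theorem continuous_mixedDeriv {g : (Fin n → ℝ) → ℝ} (hg : ContDiff ℝ n g) :
    Continuous (mixedDeriv g) :=
  (hg.continuous_iteratedFDeriv le_rfl).eval_const _

theorem contDiff_eval {σ : Type*} [Fintype σ] {N : WithTop ℕ∞} (p : MvPolynomial σ ℝ) :
    ContDiff ℝ N fun x : σ → ℝ => eval x p :=
  (AnalyticOnNhd.eval_mvPolynomial p).contDiff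

theorem fderiv_eval_single {σ : Type*} [Finite σ] [DecidableEq σ] (p : MvPolynomial σ ℝ) (i : σ)
    (x : σ → ℝ) :
    fderiv ℝ (fun x : σ → ℝ => eval x p) x (Pi.single i 1) = eval x (pderiv i p) := by
  cases nonempty_fintype σ
  have hdiff (q : MvPolynomial σ ℝ) : DifferentiableAt ℝ (fun x : σ → ℝ => eval x q) x :=
    (contDiff_eval (N := 1) q).differentiable one_ne_zero x
  induction p using MvPolynomial.induction_on with
  | C a => simp
  | add p q hp hq => simp [fderiv_fun_add (hdiff p) (hdiff q), hp, hq]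
  | mul_X p j hp =>
    have hX : HasFDerivAt (fun x : σ → ℝ => x j) (ContinuousLinearMap.proj j) x :=
      (ContinuousLinearMap.proj (R := ℝ) (φ := fun _ : σ => ℝ) j).hasFDerivAt
    simp [fderiv_fun_mul (hdiff p) hX.differentiableAt, hX.fderiv, hp, pderiv_X, Pi.single_apply,
      eq_comm, apply_ite]

theorem iteratedFDeriv_eval_single {σ : Type*} [Fintype σ] [DecidableEq σ] (p : MvPolynomial σ ℝ)
    {k : ℕ} (m : Fin k → σ) (x : σ → ℝ) :
    iteratedFDeriv ℝ k (fun x : σ → ℝ => eval x p) x (fun j => Pi.single (m j) 1) =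
      eval x ((List.ofFn m).foldr (fun i q => pderiv i q) p) := by
  induction k generalizing x with
  | zero => simp
  | succ k ih =>
    rw [iteratedFDeriv_succ_apply_eq_fderiv (contDiff_eval p), List.ofFn_succ, List.foldr_cons,
      ← fderiv_eval_single]
    congr 2 with y
    exact ih (Fin.tail m) y

theorem mixedDeriv_eval (p : MvPolynomial (Fin n) ℝ) :
    (mixedDeriv fun x => eval x p) = fun x => eval x (mixedPartial p) := by
  ext x
  exact (iteratedFDeriv_eval_single p id x).trans (by rw [List.ofFn_id, mixedPartial])

theorem contDiff_cons {N : WithTop ℕ∞} (c : ℝ) :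
    ContDiff ℝ N fun y : Fin n → ℝ => (Fin.cons c y : Fin (n + 1) → ℝ) :=
  contDiff_pi.2 <| Fin.cases contDiff_const fun i => contDiff_apply ℝ ℝ i

theorem mixedDeriv_comp_cons {g : (Fin (n + 1) → ℝ) → ℝ} (hg : ContDiff ℝ n g) (c : ℝ)
    (y : Fin n → ℝ) :
    mixedDeriv (fun y : Fin n → ℝ => g (Fin.cons c y)) y =
      iteratedFDeriv ℝ n g (Fin.cons c y) fun i => Pi.single i.succ 1 := by
  let L : (Fin n → ℝ) →L[ℝ] (Fin (n + 1) → ℝ) :=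
    ContinuousLinearMap.pi (Fin.cons 0 fun i => ContinuousLinearMap.proj i)
  have hL (y : Fin n → ℝ) : L y = Fin.cons 0 y := by
    ext i; cases i using Fin.cases <;> simp [L]
  have hcons (y : Fin n → ℝ) : (Fin.cons c y : Fin (n + 1) → ℝ) = L y + Fin.cons c 0 := by
    ext i; cases i using Fin.cases <;> simp [hL]
  have hsingle (i : Fin n) : L (Pi.single i 1) = Pi.single i.succ 1 := by
    ext j
    cases j using Fin.cases with
    | zero => simp [hL, (Fin.succ_ne_zero i).symm]
    | succ j => simp [hL, Pi.single_apply]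
  have hg' : ContDiff ℝ n fun z => g (z + Fin.cons c 0) := hg.comp (contDiff_id.add contDiff_const)
  have hcomp : (fun y => g (Fin.cons c y)) = (fun z => g (z + Fin.cons c 0)) ∘ L :=
    funext fun y => congrArg g (hcons y)
  rw [mixedDeriv, hcomp, L.iteratedFDeriv_comp_right hg' y le_rfl, iteratedFDeriv_comp_add_right,
    ← hcons, ContinuousMultilinearMap.compContinuousLinearMap_apply]
  simp only [hsingle]

theorem setIntegral_Icc_fderiv_single_zero {ψ : (Fin (n + 1) → ℝ) → ℝ} (hψ : ContDiff ℝ 1 ψ)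
    {a b : Fin (n + 1) → ℝ} (hab : a ≤ b) :
    ∫ x in Icc a b, fderiv ℝ ψ x (Pi.single 0 1) =
      (∫ y in Icc (Fin.tail a) (Fin.tail b), ψ (Fin.cons (b 0) y)) -
        ∫ y in Icc (Fin.tail a) (Fin.tail b), ψ (Fin.cons (a 0) y) := by
  let V : Fin (n + 1) → (Fin (n + 1) → ℝ) → ℝ := Fin.cons ψ fun _ _ => 0
  let V' : Fin (n + 1) → (Fin (n + 1) → ℝ) → (Fin (n + 1) → ℝ) →L[ℝ] ℝ :=
    Fin.cons (fderiv ℝ ψ) fun _ => 0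
  have hdiv (x) : ∑ i, V' i x (Pi.single i 1) = fderiv ℝ ψ x (Pi.single 0 1) := by
    simp [V', Fin.sum_univ_succ]
  have key := integral_divergence_of_hasFDerivAt_off_countable' a b hab V V' ∅ countable_empty
    (Fin.cases hψ.continuous.continuousOn fun _ => continuousOn_const)
    (fun x _ => Fin.cases (hψ.differentiable one_ne_zero x).hasFDerivAt
      fun _ => hasFDerivAt_const _ _)
    (by
      simp only [hdiv]
      exact ((hψ.continuous_fderiv one_ne_zero).clm_apply
        continuous_const).continuousOn.integrableOn_compact isCompact_Icc)
  simp only [hdiv] at key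
  simp only [V, Fin.sum_univ_succ, Fin.insertNth_zero', Fin.cons_zero, Fin.cons_succ,
    integral_zero, sub_zero, Finset.sum_const_zero, add_zero] at key
  exact key

/-- The vertex of the box `[a, b]` whose `i`-th coordinate is `b i` where `ε i` holds and `a i`
elsewhere. -/
def boxVertex {ι : Type*} (a b : ι → ℝ) (ε : ι → Bool) : ι → ℝ :=
  fun i => if ε i then b i else a i

/-- The sign `(-1) ^ #{i | ε i = false}` with which the vertex `boxVertex a b ε` enters the
alternating sum over the vertices of a box. -/
def vertexSign {ι : Type*} [Fintype ι] (ε : ι → Bool) : ℝ :=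
  ∏ i, if ε i then 1 else -1

theorem sum_boxVertex_succ (g : (Fin (n + 1) → ℝ) → ℝ) (a b : Fin (n + 1) → ℝ) :
    ∑ ε, vertexSign ε * g (boxVertex a b ε) =
      (∑ ε, vertexSign ε * g (Fin.cons (b 0) (boxVertex (Fin.tail a) (Fin.tail b) ε))) -
        ∑ ε, vertexSign ε * g (Fin.cons (a 0) (boxVertex (Fin.tail a) (Fin.tail b) ε)) := by
  have hsign (c : Bool) (ε : Fin n → Bool) :
      vertexSign (Fin.cons c ε : Fin (n + 1) → Bool) = (if c then 1 else -1) * vertexSign ε := by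
    simp [vertexSign, Fin.prod_univ_succ]
  have hvertex (c : Bool) (ε : Fin n → Bool) : boxVertex a b (Fin.cons c ε) =
      Fin.cons (if c then b 0 else a 0) (boxVertex (Fin.tail a) (Fin.tail b) ε) := by
    ext i; cases i using Fin.cases <;> simp [boxVertex, Fin.tail]
  rw [← (Fin.consEquiv fun _ => Bool).sum_comp, Fintype.sum_prod_type, Fintype.sum_bool]
  simp [Fin.consEquiv, hsign, hvertex, Finset.sum_neg_distrib, sub_eq_add_neg]

theorem setIntegral_Icc_mixedDeriv {g : (Fin n → ℝ) → ℝ} (hg : ContDiff ℝ n g)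
    {a b : Fin n → ℝ} (hab : a ≤ b) :
    ∫ x in Icc a b, mixedDeriv g x = ∑ ε, vertexSign ε * g (boxVertex a b ε) := by
  induction n with
  | zero =>
    have hvol : (volume : Measure (Fin 0 → ℝ)) = Measure.dirac a := by
      rw [volume_pi]; exact Measure.pi_of_empty _ _
    have huniv : Icc a b = univ := eq_univ_of_forall fun x => by
      simp [Subsingleton.elim x a, Subsingleton.elim b a]
    simp [hvol, huniv, mixedDeriv, vertexSign, Subsingleton.elim (boxVertex a b _) a]
  | succ n ih =>
    have hface (c : ℝ) :
        ∫ y in Icc (Fin.tail a) (Fin.tail b),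
            iteratedFDeriv ℝ n g (Fin.cons c y) (fun i => Pi.single i.succ 1) =
          ∑ ε, vertexSign ε * g (Fin.cons c (boxVertex (Fin.tail a) (Fin.tail b) ε)) := by
      simp only [← mixedDeriv_comp_cons (hg.of_le (by exact_mod_cast n.le_succ)) c]
      exact ih ((hg.of_le (by exact_mod_cast n.le_succ)).comp (contDiff_cons c))
        fun i => hab i.succ
    have hdirs : ContDiff ℝ 1 fun x => iteratedFDeriv ℝ n g x fun i => Pi.single i.succ 1 :=
      (ContinuousMultilinearMap.apply ℝ (fun _ : Fin n => Fin (n + 1) → ℝ) ℝ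
        fun i => Pi.single i.succ 1).contDiff.comp
        (hg.iteratedFDeriv_right (m := 1) (i := n) (by rw [add_comm]; norm_cast))
    simp only [mixedDeriv, iteratedFDeriv_succ_apply_eq_fderiv (by exact_mod_cast hg)]
    exact (setIntegral_Icc_fderiv_single_zero hdirs hab).trans
      (by rw [hface, hface, sum_boxVertex_succ])

end MixedDeriv

/-! ### Bernstein expansions -/

section Bernstein

theorem sum_choose_mul_choose_mul_pow {R : Type*} [CommRing R] {x y : R} (hxy : x + y = 1)
    {a N : ℕ} (ha : a ≤ N) :
    ∑ k ∈ Finset.range (N + 1), ((N.choose k * k.choose a : ℕ) : R) * (x ^ k * y ^ (N - k)) =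
      (N.choose a : R) * x ^ a := by
  obtain ⟨m, rfl⟩ := Nat.exists_eq_add_of_le ha
  have hlow : ∑ k ∈ Finset.range a,
      (((a + m).choose k * k.choose a : ℕ) : R) * (x ^ k * y ^ (a + m - k)) = 0 :=
    Finset.sum_eq_zero fun k hk => by simp [Nat.choose_eq_zero_of_lt (Finset.mem_range.1 hk)]
  have hterm (j : ℕ) : (((a + m).choose (a + j) * (a + j).choose a : ℕ) : R) *
      (x ^ (a + j) * y ^ (a + m - (a + j))) =
      ((a + m).choose a : R) * x ^ a * (x ^ j * y ^ (m - j) * (m.choose j : R)) := by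
    rw [Nat.choose_mul (Nat.le_add_right a j), Nat.add_sub_cancel_left, Nat.add_sub_cancel_left,
      Nat.add_sub_add_left]
    push_cast
    ring
  rw [add_assoc, Finset.sum_range_add, hlow, zero_add]
  simp only [hterm]
  rw [← Finset.mul_sum, ← add_pow, hxy, one_pow, mul_one]

theorem abs_prod_sub_prod_le_sum {ι : Type*} (s : Finset ι) {u v : ι → ℝ}
    (hu : ∀ i ∈ s, u i ∈ Icc 0 1) (hv : ∀ i ∈ s, v i ∈ Icc 0 1) :
    |∏ i ∈ s, u i - ∏ i ∈ s, v i| ≤ ∑ i ∈ s, |u i - v i| := by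
  classical
  induction s using Finset.induction_on with
  | empty => simp
  | insert i s hi ih =>
    rw [Finset.forall_mem_insert] at hu hv
    rw [Finset.prod_insert hi, Finset.prod_insert hi, Finset.sum_insert hi]
    have hv_prod : |∏ j ∈ s, v j| ≤ 1 := by
      rw [Finset.abs_prod]
      exact Finset.prod_le_one (fun j _ => abs_nonneg _) fun j hj =>
        (abs_of_nonneg (hv.2 j hj).1).trans_le (hv.2 j hj).2
    have hu_i : |u i| ≤ 1 := (abs_of_nonneg hu.1.1).trans_le hu.1.2
    calc |u i * ∏ j ∈ s, u j - v i * ∏ j ∈ s, v j|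
        = |(u i - v i) * ∏ j ∈ s, v j + u i * (∏ j ∈ s, u j - ∏ j ∈ s, v j)| := by ring_nf
      _ ≤ |u i - v i| * |∏ j ∈ s, v j| + |u i| * |∏ j ∈ s, u j - ∏ j ∈ s, v j| := by
        simpa only [abs_mul] using
          abs_add_le ((u i - v i) * ∏ j ∈ s, v j) (u i * (∏ j ∈ s, u j - ∏ j ∈ s, v j))
      _ ≤ |u i - v i| + ∑ j ∈ s, |u j - v j| :=
        add_le_add (mul_le_of_le_one_right (abs_nonneg _) hv_prod)
          ((mul_le_of_le_one_left (abs_nonneg _) hu_i).trans (ih hu.2 hv.2))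

/-- The coefficient of `x ^ a` with respect to the Bernstein basis
`(N choose k) x ^ k (1 - x) ^ (N - k)`, `k ≤ N`, of the polynomials of degree at most `N`; it is
meaningful for `a ≤ N` only. -/
noncomputable def bernsteinCoeff (N k a : ℕ) : ℝ :=
  k.choose a / N.choose a

theorem bernsteinCoeff_mem_Icc {N k : ℕ} (a : ℕ) (hk : k ≤ N) : bernsteinCoeff N k a ∈ Icc 0 1 :=
  ⟨by unfold bernsteinCoeff; positivity,
    div_le_one_of_le₀ (by exact_mod_cast Nat.choose_le_choose a hk) (by positivity)⟩

theorem bernsteinCoeff_eq_prod (N k a : ℕ) :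
    bernsteinCoeff N k a = ∏ j ∈ Finset.range a, ((k - j : ℕ) : ℝ) / (N - j : ℕ) := by
  have ha : (a.factorial : ℝ) ≠ 0 := by exact_mod_cast a.factorial_ne_zero
  rw [Finset.prod_div_distrib, ← Nat.cast_prod, ← Nat.cast_prod,
    ← Nat.descFactorial_eq_prod_range, ← Nat.descFactorial_eq_prod_range,
    Nat.descFactorial_eq_factorial_mul_choose, Nat.descFactorial_eq_factorial_mul_choose,
    Nat.cast_mul, Nat.cast_mul, mul_div_mul_left _ _ ha, bernsteinCoeff]

theorem abs_sub_div_sub_sub_div_le {N k j : ℕ} (hk : k ≤ N) (hj : j < N) :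
    |((k - j : ℕ) : ℝ) / (N - j : ℕ) - k / N| ≤ j / N := by
  have hN : (0 : ℝ) < N := by exact_mod_cast j.zero_le.trans_lt hj
  rcases le_total k j with hkj | hjk
  · rw [Nat.sub_eq_zero_of_le hkj, Nat.cast_zero, zero_div, zero_sub, abs_neg,
      abs_of_nonneg (by positivity)]
    gcongr
  · have hNj : (0 : ℝ) < N - j := sub_pos.2 (by exact_mod_cast hj)
    have hk' : (k : ℝ) ≤ N := by exact_mod_cast hk
    have hjk' : (j : ℝ) ≤ k := by exact_mod_cast hjk
    have hdiff : ((k : ℝ) - j) / (N - j) - k / N = -(j / N * ((N - k) / (N - j))) := by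
      field_simp
      ring
    rw [Nat.cast_sub hjk, Nat.cast_sub hj.le, hdiff, abs_neg,
      abs_of_nonneg (mul_nonneg (by positivity) (div_nonneg (by linarith) hNj.le))]
    exact mul_le_of_le_one_right (by positivity) (div_le_one_of_le₀ (by linarith) hNj.le)

theorem abs_bernsteinCoeff_sub_pow_le {N k a : ℕ} (hk : k ≤ N) (ha : a ≤ N) :
    |bernsteinCoeff N k a - (k / N : ℝ) ^ a| ≤ (a : ℝ) ^ 2 / N := by
  have hfrac {p q : ℕ} (hpq : p ≤ q) : (p / q : ℝ) ∈ Icc 0 1 :=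
    ⟨by positivity, div_le_one_of_le₀ (by exact_mod_cast hpq) (by positivity)⟩
  have hpow : (k / N : ℝ) ^ a = ∏ _j ∈ Finset.range a, (k / N : ℝ) := by
    rw [Finset.prod_const, Finset.card_range]
  rw [bernsteinCoeff_eq_prod, hpow]
  calc _ ≤ ∑ j ∈ Finset.range a, |((k - j : ℕ) : ℝ) / (N - j : ℕ) - k / N| :=
        abs_prod_sub_prod_le_sum _ (fun j _ => hfrac (Nat.sub_le_sub_right hk j))
          fun _ _ => hfrac hk
    _ ≤ ∑ _j ∈ Finset.range a, (a / N : ℝ) := by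
        refine Finset.sum_le_sum fun j hj => ?_
        have hj := Finset.mem_range.1 hj
        exact (abs_sub_div_sub_sub_div_le hk (hj.trans_le ha)).trans (by gcongr)
    _ = (a : ℝ) ^ 2 / N := by
        rw [Finset.sum_const, Finset.card_range, nsmul_eq_mul]
        ring

variable {n : ℕ}

/-- The multi-indices `k ∈ {0, …, N}^n`. -/
def gridIndex (n N : ℕ) : Finset (Fin n → ℕ) :=
  Fintype.piFinset fun _ => Finset.range (N + 1)

theorem mem_gridIndex {N : ℕ} {k : Fin n → ℕ} : k ∈ gridIndex n N ↔ ∀ i, k i ≤ N := by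
  simp [gridIndex, Fintype.mem_piFinset]

/-- The grid point `k / N`, at which the Bernstein polynomial of index `k` and degree `N` in each
variable concentrates. -/
noncomputable def gridPoint (N : ℕ) (k : Fin n → ℕ) : Fin n → ℝ :=
  fun i => k i / N

theorem gridPoint_mem_unitCube {N : ℕ} {k : Fin n → ℕ} (hk : k ∈ gridIndex n N) :
    gridPoint N k ∈ unitCube n :=
  ⟨fun i => div_nonneg (k i).cast_nonneg N.cast_nonneg,
    fun i => div_le_one_of_le₀ (Nat.cast_le.2 (mem_gridIndex.1 hk i)) N.cast_nonneg⟩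

/-- The Bernstein polynomial `∏ i, (N choose k_i) x_i ^ k_i (1 - x_i) ^ (N - k_i)`. -/
noncomputable def bernsteinBasis (N : ℕ) (k : Fin n → ℕ) : MvPolynomial (Fin n) ℝ :=
  (∏ i, (N.choose (k i) : ℝ)) • bernsteinProd k fun i => N - k i

theorem X_pow_eq_sum_bernsteinCoeff {σ : Type*} (i : σ) {a N : ℕ} (ha : a ≤ N) :
    (X i : MvPolynomial σ ℝ) ^ a = ∑ k ∈ Finset.range (N + 1),
      C (bernsteinCoeff N k a * N.choose k) * (X i ^ k * (1 - X i) ^ (N - k)) := by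
  have hN : (N.choose a : ℝ) ≠ 0 := by exact_mod_cast (Nat.choose_pos ha).ne'
  calc (X i : MvPolynomial σ ℝ) ^ a
      = C (N.choose a : ℝ)⁻¹ * ((N.choose a : MvPolynomial σ ℝ) * X i ^ a) := by
        rw [← mul_assoc, ← C_eq_coe_nat, ← C_mul, inv_mul_cancel₀ hN, C_1, one_mul]
    _ = _ := by
        rw [← sum_choose_mul_choose_mul_pow (add_sub_cancel (X i) 1) ha, Finset.mul_sum]
        refine Finset.sum_congr rfl fun k _ => ?_
        rw [← mul_assoc, ← C_eq_coe_nat, ← C_mul, bernsteinCoeff]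
        push_cast
        ring_nf

theorem prod_X_pow_eq_sum_bernsteinBasis {N : ℕ} {α : Fin n → ℕ} (hα : ∀ i, α i ≤ N) :
    ∏ i, (X i : MvPolynomial (Fin n) ℝ) ^ α i =
      ∑ k ∈ gridIndex n N, (∏ i, bernsteinCoeff N (k i) (α i)) • bernsteinBasis N k := by
  rw [Finset.prod_congr rfl fun i _ => X_pow_eq_sum_bernsteinCoeff i (hα i), Finset.prod_univ_sum]
  refine Finset.sum_congr rfl fun k _ => ?_
  rw [bernsteinBasis, smul_smul, ← Finset.prod_mul_distrib, Finset.prod_mul_distrib,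
    Finset.prod_mul_distrib, ← map_prod, C_mul', bernsteinProd]

theorem abs_prod_bernsteinCoeff_sub_le {N : ℕ} {α k : Fin n → ℕ} (hα : ∀ i, α i ≤ N)
    (hk : k ∈ gridIndex n N) :
    |∏ i, bernsteinCoeff N (k i) (α i) - ∏ i, gridPoint N k i ^ α i| ≤
      (∑ i, (α i : ℝ) ^ 2) / N := by
  have hgrid := gridPoint_mem_unitCube hk
  rw [mem_gridIndex] at hk
  rw [Finset.sum_div]
  exact (abs_prod_sub_prod_le_sum _ (fun i _ => bernsteinCoeff_mem_Icc _ (hk i)) fun i _ =>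
      ⟨pow_nonneg (hgrid.1 i) _, pow_le_one₀ (hgrid.1 i) (hgrid.2 i)⟩).trans
    (Finset.sum_le_sum fun i _ => abs_bernsteinCoeff_sub_pow_le (hk i) (hα i))

theorem tendsto_sum_prod_gridPoint_pow_mul {L : MvPolynomial (Fin n) ℝ →ₗ[ℝ] ℝ} {C : ℝ}
    (hC : ∀ N : ℕ, ∑ k ∈ gridIndex n N, |L (bernsteinBasis N k)| ≤ C) (α : Fin n → ℕ) :
    Tendsto (fun N : ℕ => ∑ k ∈ gridIndex n N, (∏ i, gridPoint N k i ^ α i) *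
      L (bernsteinBasis N k)) atTop (𝓝 (L (∏ i, X i ^ α i))) := by
  set K : ℝ := ∑ i, (α i : ℝ) ^ 2
  have hbound : ∀ᶠ N : ℕ in atTop, |∑ k ∈ gridIndex n N, (∏ i, gridPoint N k i ^ α i) *
      L (bernsteinBasis N k) - L (∏ i, X i ^ α i)| ≤ K / N * C := by
    filter_upwards [eventually_all.2 fun i => eventually_ge_atTop (α i)] with N hα
    rw [prod_X_pow_eq_sum_bernsteinBasis hα, map_sum, ← Finset.sum_sub_distrib]
    calc _ ≤ ∑ k ∈ gridIndex n N, K / N * |L (bernsteinBasis N k)| := by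
          refine (Finset.abs_sum_le_sum_abs _ _).trans (Finset.sum_le_sum fun k hk => ?_)
          rw [map_smul, smul_eq_mul, ← sub_mul, abs_mul, abs_sub_comm]
          gcongr
          exact abs_prod_bernsteinCoeff_sub_le hα hk
      _ ≤ K / N * C := by
          rw [← Finset.mul_sum]
          gcongr
          exact hC N
  have hlim : Tendsto (fun N : ℕ => K / N * C) atTop (𝓝 0) := by
    simpa using (tendsto_const_div_atTop_nhds_zero_nat K).mul_const C
  exact tendsto_sub_nhds_zero_iff.1 (squeeze_zero_norm' hbound hlim)

theorem tendsto_sum_eval_gridPoint_mul {L : MvPolynomial (Fin n) ℝ →ₗ[ℝ] ℝ} {C : ℝ}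
    (hC : ∀ N : ℕ, ∑ k ∈ gridIndex n N, |L (bernsteinBasis N k)| ≤ C)
    (p : MvPolynomial (Fin n) ℝ) :
    Tendsto (fun N : ℕ => ∑ k ∈ gridIndex n N, eval (gridPoint N k) p * L (bernsteinBasis N k))
      atTop (𝓝 (L p)) := by
  induction p using MvPolynomial.induction_on' with
  | monomial α c =>
    simpa [eval_monomial, monomial_eq, C_mul', Finsupp.prod_fintype, Finset.mul_sum, mul_assoc]
      using (tendsto_sum_prod_gridPoint_pow_mul hC α).const_mul c
  | add p q hp hq => simpa [add_mul, Finset.sum_add_distrib] using hp.add hq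

end Bernstein

/-! ### The Hausdorff moment problem for signed measures -/

section WeakCompactness

variable {E : Type*} [TopologicalSpace E] [MeasurableSpace E] [OpensMeasurableSpace E]
  {K : Set E} {g : E → ℝ}

theorem integrable_of_continuous_of_measure_compl_eq_zero [T2Space E] {μ : Measure E}
    [IsFiniteMeasure μ] (hK : IsCompact K) (hμ : μ Kᶜ = 0) (hg : Continuous g) :
    Integrable g μ := by
  obtain ⟨M, hM⟩ := hK.exists_bound_of_continuousOn hg.continuousOn
  have hgm : AEStronglyMeasurable g μ := hg.measurable.aestronglyMeasurable
  exact Integrable.of_bound hgm M (mem_of_superset (mem_ae_iff.2 hμ) hM)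

theorem tendsto_integral_of_measure_compl_eq_zero {ι : Type*} {F : Filter ι}
    {μs : ι → FiniteMeasure E} {μ : FiniteMeasure E} (hlim : Tendsto μs F (𝓝 μ))
    (hK : IsCompact K) (hμs : ∀ i, (μs i : Measure E) Kᶜ = 0) (hμ : (μ : Measure E) Kᶜ = 0)
    (hg : Continuous g) :
    Tendsto (fun i => ∫ x, g x ∂(μs i : Measure E)) F (𝓝 (∫ x, g x ∂(μ : Measure E))) := by
  obtain ⟨M, hM⟩ := hK.exists_bound_of_continuousOn hg.continuousOn
  let G : BoundedContinuousFunction E ℝ :=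
    .ofNormedAddCommGroup (fun x => max (-|M|) (min (g x) |M|)) (by fun_prop) |M| fun x =>
      abs_le.2 ⟨le_max_left _ _, max_le (by simp) (min_le_right _ _)⟩
  have hG (x) (hx : x ∈ K) : G x = g x := by
    have hgx := abs_le.1 ((hM x hx).trans (le_abs_self M))
    exact (congrArg _ (min_eq_left hgx.2)).trans (max_eq_right hgx.1)
  have hint {ν : Measure E} (hν : ν Kᶜ = 0) : ∫ x, G x ∂ν = ∫ x, g x ∂ν :=
    integral_congr_ae (mem_of_superset (mem_ae_iff.2 hν) hG)
  simpa only [hint (hμs _), hint hμ] using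
    FiniteMeasure.tendsto_iff_forall_integral_tendsto.1 hlim G

theorem exists_tendsto_integral_of_measure_le [T2Space E] [BorelSpace E] {ι : Type*}
    (F : Ultrafilter ι) {μs : ι → Measure E} [∀ i, IsFiniteMeasure (μs i)] {C : ℝ≥0}
    (hmass : ∀ i, μs i univ ≤ C) (hK : IsCompact K) (hμs : ∀ i, μs i Kᶜ = 0) :
    ∃ μ : Measure E, IsFiniteMeasure μ ∧ μ Kᶜ = 0 ∧
      ∀ g : E → ℝ, Continuous g → Tendsto (fun i => ∫ x, g x ∂μs i) F (𝓝 (∫ x, g x ∂μ)) := by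
  let νs (i : ι) : FiniteMeasure E := ⟨μs i, inferInstance⟩
  have hνs (i) : νs i ∈ {ν : FiniteMeasure E | ν.mass ≤ C ∧ ν Kᶜ = 0} :=
    ⟨ENNReal.coe_le_coe.1 ((νs i).ennreal_mass.trans_le (hmass i)),
      (FiniteMeasure.null_iff_toMeasure_null _ _).2 (hμs i)⟩
  obtain ⟨μ, ⟨-, hμ⟩, hlim⟩ :=
    (isCompact_setOfPred_finiteMeasure_le_of_isCompact C hK).ultrafilter_le_nhds (F.map νs)
      (le_principal_iff.2 (mem_map.2 (univ_mem' hνs)))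
  have hμ := (FiniteMeasure.null_iff_toMeasure_null _ _).1 hμ
  exact ⟨μ, inferInstance, hμ, fun g hg =>
    tendsto_integral_of_measure_compl_eq_zero (μs := νs) hlim hK hμs hμ hg⟩

end WeakCompactness

section Hausdorff

variable {n : ℕ} {L : MvPolynomial (Fin n) ℝ →ₗ[ℝ] ℝ} {C : ℝ}

theorem isCompact_unitCube : IsCompact (unitCube n) := isCompact_Icc

theorem measurableSet_unitCube : MeasurableSet (unitCube n) := measurableSet_Icc

/-- `L` is integration against the signed measure `μ - ν` on the unit cube. -/
structure IsRepresentedBy (L : MvPolynomial (Fin n) ℝ →ₗ[ℝ] ℝ) (μ ν : Measure (Fin n → ℝ)) :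
    Prop where
  left_compl : μ (unitCube n)ᶜ = 0
  right_compl : ν (unitCube n)ᶜ = 0
  apply_eq : ∀ p, L p = (∫ x, eval x p ∂μ) - ∫ x, eval x p ∂ν

/-- The discretization of degree `N` of the positive part of the signed measure representing `L`:
the grid point `k / N` carries the positive part of the mass `L (bernsteinBasis N k)`. -/
noncomputable def bernsteinMeasure (L : MvPolynomial (Fin n) ℝ →ₗ[ℝ] ℝ) (N : ℕ) :
    Measure (Fin n → ℝ) :=
  ∑ k ∈ gridIndex n N, ENNReal.ofReal (L (bernsteinBasis N k)) • Measure.dirac (gridPoint N k)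

theorem bernsteinMeasure_univ_le {N : ℕ}
    (hC : ∑ k ∈ gridIndex n N, |L (bernsteinBasis N k)| ≤ C) :
    bernsteinMeasure L N univ ≤ C.toNNReal := by
  calc bernsteinMeasure L N univ = ∑ k ∈ gridIndex n N, ENNReal.ofReal (L (bernsteinBasis N k)) :=
        by simp [bernsteinMeasure]
    _ ≤ ∑ k ∈ gridIndex n N, ENNReal.ofReal |L (bernsteinBasis N k)| := by
        gcongr; exact le_abs_self _
    _ ≤ ENNReal.ofReal C := by
        rw [← ENNReal.ofReal_sum_of_nonneg fun _ _ => abs_nonneg _]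
        exact ENNReal.ofReal_le_ofReal hC

theorem bernsteinMeasure_compl_unitCube (L : MvPolynomial (Fin n) ℝ →ₗ[ℝ] ℝ) (N : ℕ) :
    bernsteinMeasure L N (unitCube n)ᶜ = 0 := by
  simp only [bernsteinMeasure, Measure.coe_finsetSum, Finset.sum_apply, Measure.smul_apply]
  refine Finset.sum_eq_zero fun k hk => ?_
  rw [Measure.dirac_apply' _ measurableSet_unitCube.compl,
    indicator_of_notMem (notMem_compl_iff.2 (gridPoint_mem_unitCube hk)), smul_zero]

theorem integral_bernsteinMeasure (L : MvPolynomial (Fin n) ℝ →ₗ[ℝ] ℝ) (N : ℕ)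
    (g : (Fin n → ℝ) → ℝ) :
    ∫ x, g x ∂bernsteinMeasure L N =
      ∑ k ∈ gridIndex n N, g (gridPoint N k) * (L (bernsteinBasis N k))⁺ := by
  rw [bernsteinMeasure, integral_finsetSum_measure fun k _ =>
    (integrable_dirac (by simp)).smul_measure ENNReal.ofReal_ne_top]
  refine Finset.sum_congr rfl fun k _ => ?_
  rw [integral_smul_measure, integral_dirac, ENNReal.toReal_ofReal', smul_eq_mul, mul_comm]
  rfl

theorem exists_tendsto_sum_posPart
    (hC : ∀ N : ℕ, ∑ k ∈ gridIndex n N, |L (bernsteinBasis N k)| ≤ C) :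
    ∃ μ : Measure (Fin n → ℝ), IsFiniteMeasure μ ∧ μ (unitCube n)ᶜ = 0 ∧
      ∀ p, Tendsto (fun N : ℕ => ∑ k ∈ gridIndex n N,
        eval (gridPoint N k) p * (L (bernsteinBasis N k))⁺) (hyperfilter ℕ)
        (𝓝 (∫ x, eval x p ∂μ)) := by
  have hfin (N) : IsFiniteMeasure (bernsteinMeasure L N) :=
    ⟨(bernsteinMeasure_univ_le (hC N)).trans_lt ENNReal.coe_lt_top⟩
  obtain ⟨μ, hμfin, hμ, hlim⟩ := exists_tendsto_integral_of_measure_le (hyperfilter ℕ)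
    (fun N => bernsteinMeasure_univ_le (hC N)) isCompact_unitCube
    (bernsteinMeasure_compl_unitCube L)
  exact ⟨μ, hμfin, hμ, fun p => by
    simpa only [integral_bernsteinMeasure] using hlim _ p.continuous_eval⟩

theorem exists_isRepresentedBy_of_sum_abs_le
    (hC : ∀ N : ℕ, ∑ k ∈ gridIndex n N, |L (bernsteinBasis N k)| ≤ C) :
    ∃ μ ν : Measure (Fin n → ℝ), IsFiniteMeasure μ ∧ IsFiniteMeasure ν ∧
      IsRepresentedBy L μ ν := by
  obtain ⟨μ, hμfin, hμ, hμlim⟩ := exists_tendsto_sum_posPart hC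
  obtain ⟨ν, hνfin, hν, hνlim⟩ := exists_tendsto_sum_posPart (L := -L) (C := C) (by simpa using hC)
  refine ⟨μ, ν, hμfin, hνfin, hμ, hν, fun p => tendsto_nhds_unique
    ((tendsto_sum_eval_gridPoint_mul hC p).mono_left Nat.hyperfilter_le_atTop)
    (((hμlim p).sub (hνlim p)).congr fun N => ?_)⟩
  simp only [← Finset.sum_sub_distrib, ← mul_sub, LinearMap.neg_apply, posPart_neg,
    posPart_sub_negPart]

theorem sum_bernsteinBasis (n N : ℕ) : ∑ k ∈ gridIndex n N, bernsteinBasis N k = 1 := by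
  simpa [bernsteinCoeff] using
    (prod_X_pow_eq_sum_bernsteinBasis (n := n) (α := 0) fun _ => N.zero_le).symm

theorem exists_isRepresentedBy_of_bernsteinProd_nonneg
    (hL : ∀ k l : Fin n → ℕ, 0 ≤ L (bernsteinProd k l)) :
    ∃ μ : Measure (Fin n → ℝ), IsFiniteMeasure μ ∧ IsRepresentedBy L μ 0 := by
  have hbasis (N) (k : Fin n → ℕ) : 0 ≤ L (bernsteinBasis N k) := by
    rw [bernsteinBasis, map_smul, smul_eq_mul]
    exact mul_nonneg (Finset.prod_nonneg fun i _ => Nat.cast_nonneg _) (hL _ _)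
  have hsum (N : ℕ) : ∑ k ∈ gridIndex n N, |L (bernsteinBasis N k)| ≤ L 1 := by
    simp only [abs_of_nonneg (hbasis N _), ← map_sum, sum_bernsteinBasis, le_refl]
  obtain ⟨μ, hμfin, hμ, hlim⟩ := exists_tendsto_sum_posPart hsum
  refine ⟨μ, hμfin, hμ, rfl, fun p => ?_⟩
  rw [integral_zero_measure, sub_zero]
  simp only [posPart_of_nonneg (hbasis _ _)] at hlim
  exact tendsto_nhds_unique
    ((tendsto_sum_eval_gridPoint_mul hsum p).mono_left Nat.hyperfilter_le_atTop) (hlim p)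

theorem eval_bernsteinProd_nonneg (k l : Fin n → ℕ) {x : Fin n → ℝ} (hx : x ∈ unitCube n) :
    0 ≤ eval x (bernsteinProd k l) := by
  simp only [bernsteinProd, map_mul, map_prod, map_pow, map_sub, map_one, eval_X]
  exact mul_nonneg (Finset.prod_nonneg fun i _ => pow_nonneg (hx.1 i) _)
    (Finset.prod_nonneg fun i _ => pow_nonneg (sub_nonneg.2 (hx.2 i)) _)

theorem sum_choose_mul_eval_bernsteinProd (d : Fin n → ℕ) (x : Fin n → ℝ) :
    ∑ k ∈ Fintype.piFinset (fun i => Finset.range (d i + 1)), (∏ i, ((d i).choose (k i) : ℝ)) *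
      eval x (bernsteinProd k fun i => d i - k i) = 1 := by
  have hone (i) : ∑ k ∈ Finset.range (d i + 1),
      ((d i).choose k : ℝ) * (x i ^ k * (1 - x i) ^ (d i - k)) = 1 := by
    simpa using sum_choose_mul_choose_mul_pow (add_sub_cancel (x i) 1) (d i).zero_le
  calc _ = ∏ i, ∑ k ∈ Finset.range (d i + 1),
        ((d i).choose k : ℝ) * (x i ^ k * (1 - x i) ^ (d i - k)) := by
        rw [Finset.prod_univ_sum]
        simp [bernsteinProd, Finset.prod_mul_distrib]
    _ = 1 := Finset.prod_eq_one fun i _ => hone i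

theorem integrable_eval {μ : Measure (Fin n → ℝ)} [IsFiniteMeasure μ] (hμ : μ (unitCube n)ᶜ = 0)
    (p : MvPolynomial (Fin n) ℝ) : Integrable (fun x => eval x p) μ :=
  integrable_of_continuous_of_measure_compl_eq_zero isCompact_unitCube hμ p.continuous_eval

theorem sum_choose_mul_integral_bernsteinProd {μ : Measure (Fin n → ℝ)} [IsFiniteMeasure μ]
    (hμ : μ (unitCube n)ᶜ = 0) (d : Fin n → ℕ) :
    ∑ k ∈ Fintype.piFinset (fun i => Finset.range (d i + 1)), (∏ i, ((d i).choose (k i) : ℝ)) *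
      ∫ x, eval x (bernsteinProd k fun i => d i - k i) ∂μ = μ.real univ := by
  simp only [← integral_const_mul]
  rw [← integral_finsetSum _ fun k _ => (integrable_eval hμ _).const_mul _]
  simp only [sum_choose_mul_eval_bernsteinProd, integral_const, smul_eq_mul, mul_one]

theorem IsRepresentedBy.abs_apply_le {μ ν : Measure (Fin n → ℝ)} (h : IsRepresentedBy L μ ν)
    {p : MvPolynomial (Fin n) ℝ} (hp : ∀ x ∈ unitCube n, 0 ≤ eval x p) :
    |L p| ≤ (∫ x, eval x p ∂μ) + ∫ x, eval x p ∂ν := by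
  have hnonneg {ρ : Measure (Fin n → ℝ)} (hρ : ρ (unitCube n)ᶜ = 0) : 0 ≤ ∫ x, eval x p ∂ρ :=
    integral_nonneg_of_ae (mem_of_superset (mem_ae_iff.2 hρ) hp)
  rw [h.apply_eq]
  refine (abs_sub _ _).trans_eq ?_
  rw [abs_of_nonneg (hnonneg h.left_compl), abs_of_nonneg (hnonneg h.right_compl)]

theorem IsRepresentedBy.bernsteinSum_le {s : (Fin n →₀ ℕ) → ℝ} {μ ν : Measure (Fin n → ℝ)}
    [IsFiniteMeasure μ] [IsFiniteMeasure ν] (h : IsRepresentedBy (rieszFunctional s) μ ν)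
    (d : Fin n → ℕ) : bernsteinSum s d ≤ μ.real univ + ν.real univ := by
  rw [← sum_choose_mul_integral_bernsteinProd h.left_compl d,
    ← sum_choose_mul_integral_bernsteinProd h.right_compl d, ← Finset.sum_add_distrib]
  refine Finset.sum_le_sum fun k _ => ?_
  rw [← mul_add]
  exact mul_le_mul_of_nonneg_left (h.abs_apply_le fun x => eval_bernsteinProd_nonneg _ _)
    (Finset.prod_nonneg fun i _ => Nat.cast_nonneg _)

theorem sum_abs_bernsteinBasis_eq_bernsteinSum (s : (Fin n →₀ ℕ) → ℝ) (N : ℕ) :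
    ∑ k ∈ gridIndex n N, |rieszFunctional s (bernsteinBasis N k)| = bernsteinSum s fun _ => N := by
  refine Finset.sum_congr rfl fun k _ => ?_
  rw [bernsteinBasis, map_smul, smul_eq_mul, abs_mul,
    abs_of_nonneg (Finset.prod_nonneg fun i _ => Nat.cast_nonneg _)]

end Hausdorff

/-! ### Polynomial approximation and moment determinacy -/

section Density

variable {σ : Type*} {K : Set (σ → ℝ)}

theorem exists_tendstoUniformlyOn_eval (hK : IsCompact K) {g : (σ → ℝ) → ℝ} (hg : Continuous g) :
    ∃ p : ℕ → MvPolynomial σ ℝ, TendstoUniformlyOn (fun k x => eval x (p k)) g atTop K := by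
  let Φ : MvPolynomial σ ℝ →ₐ[ℝ] C(σ → ℝ, ℝ) := aeval fun i => ⟨fun x => x i, continuous_apply i⟩
  have hΦ (p x) : Φ p x = eval x p := by
    induction p using MvPolynomial.induction_on with
    | C a => simp [Φ]
    | add p q hp hq => simp [hp, hq]
    | mul_X p i hp => simp [hp, Φ]
  have hsep : Φ.range.SeparatesPoints := fun x y hxy => by
    obtain ⟨i, hi⟩ := Function.ne_iff.1 hxy
    exact ⟨_, ⟨Φ (X i), ⟨_, rfl⟩, rfl⟩, by simpa [hΦ] using hi⟩
  have happrox (ε : ℝ) (hε : 0 < ε) : ∃ p, ∀ x ∈ K, ‖eval x p - g x‖ < ε := by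
    obtain ⟨_, ⟨p, rfl⟩, hp⟩ :=
      ContinuousMap.exists_mem_subalgebra_near_continuous_of_isCompact_of_separatesPoints
        hsep ⟨g, hg⟩ hK hε
    exact ⟨p, fun x hx => by simpa [hΦ] using hp x hx⟩
  choose p hp using fun k : ℕ => happrox (1 / (k + 1)) (by positivity)
  refine ⟨p, Metric.tendstoUniformlyOn_iff.2 fun ε hε => ?_⟩
  filter_upwards [tendsto_one_div_add_atTop_nhds_zero_nat.eventually_lt_const hε] with k hk x hx
  rw [dist_comm, dist_eq_norm]
  exact (hp k x hx).trans hk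

theorem tendsto_integral_of_tendstoUniformlyOn {E : Type*} [TopologicalSpace E] [T2Space E]
    [MeasurableSpace E] [OpensMeasurableSpace E] {K : Set E} (hK : IsCompact K) {μ : Measure E}
    [IsFiniteMeasure μ] (hμ : μ Kᶜ = 0) {G : ℕ → E → ℝ} {g : E → ℝ} (hG : ∀ k, Continuous (G k))
    (hg : Continuous g) (hlim : TendstoUniformlyOn G g atTop K) :
    Tendsto (fun k => ∫ x, G k x ∂μ) atTop (𝓝 (∫ x, g x ∂μ)) := by
  have hint : Integrable (fun x => ‖g x‖ + 1) μ :=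
    integrable_of_continuous_of_measure_compl_eq_zero hK hμ (by fun_prop)
  refine tendsto_integral_filter_of_dominated_convergence _
    (Eventually.of_forall fun k => (hG k).measurable.aestronglyMeasurable) ?_ hint ?_
  · filter_upwards [Metric.tendstoUniformlyOn_iff.1 hlim 1 one_pos] with k hk
    filter_upwards [mem_ae_iff.2 hμ] with x hx
    have := norm_le_norm_add_norm_sub (g x) (G k x)
    have := hk x hx
    rw [dist_eq_norm] at this
    linarith
  · filter_upwards [mem_ae_iff.2 hμ] with x hx using hlim.tendsto_at hx

theorem measure_ext_of_integral_eval_eq [Finite σ] (hK : IsCompact K) {μ ν : Measure (σ → ℝ)}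
    [IsFiniteMeasure μ] [IsFiniteMeasure ν] (hμ : μ Kᶜ = 0) (hν : ν Kᶜ = 0)
    (h : ∀ p : MvPolynomial σ ℝ, ∫ x, eval x p ∂μ = ∫ x, eval x p ∂ν) : μ = ν := by
  cases nonempty_fintype σ
  refine ext_of_forall_integral_eq_of_IsFiniteMeasure fun g => ?_
  obtain ⟨p, hp⟩ := exists_tendstoUniformlyOn_eval hK g.continuous
  have hlim {ρ : Measure (σ → ℝ)} [IsFiniteMeasure ρ] (hρ : ρ Kᶜ = 0) :=
    tendsto_integral_of_tendstoUniformlyOn hK hρ (fun k => (p k).continuous_eval) g.continuous hp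
  exact tendsto_nhds_unique (hlim hμ) ((hlim hν).congr fun k => (h (p k)).symm)

end Density

section RieszFunctional

variable {n : ℕ} {s : (Fin n →₀ ℕ) → ℝ}

theorem rieszFunctional_monomial (s : (Fin n →₀ ℕ) → ℝ) (α : Fin n →₀ ℕ) :
    rieszFunctional s (monomial α 1) = s α := by
  simpa only [coe_basisMonomials, rieszFunctional] using
    (basisMonomials (Fin n) ℝ).constr_basis ℝ s α

theorem eq_rieszFunctional {L : MvPolynomial (Fin n) ℝ →ₗ[ℝ] ℝ}
    (h : ∀ α, L (monomial α 1) = s α) : L = rieszFunctional s :=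
  (basisMonomials (Fin n) ℝ).ext fun α => by
    rw [coe_basisMonomials, h, rieszFunctional_monomial]

/-- `mixedPartial` as a linear map. -/
noncomputable def mixedPartialLinearMap (n : ℕ) :
    MvPolynomial (Fin n) ℝ →ₗ[ℝ] MvPolynomial (Fin n) ℝ :=
  (List.finRange n).foldr (fun i T => (pderiv i).toLinearMap ∘ₗ T) LinearMap.id

theorem mixedPartialLinearMap_apply (p : MvPolynomial (Fin n) ℝ) :
    mixedPartialLinearMap n p = mixedPartial p := by
  unfold mixedPartialLinearMap mixedPartial
  induction List.finRange n with
  | nil => rfl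
  | cons i l ih => simp [ih]

theorem rieszFunctional_mixedDerivSeq (s : (Fin n →₀ ℕ) → ℝ) (p : MvPolynomial (Fin n) ℝ) :
    rieszFunctional (mixedDerivSeq s) p = (-1) ^ n * rieszFunctional s (mixedPartial p) := by
  rw [← eq_rieszFunctional (s := mixedDerivSeq s)
    (L := (-1 : ℝ) ^ n • (rieszFunctional s ∘ₗ mixedPartialLinearMap n)) fun α => by
      simp [mixedPartialLinearMap_apply, mixedDerivSeq]]
  simp [mixedPartialLinearMap_apply]

theorem rieszFunctional_eq_setIntegral {f : (Fin n → ℝ) → ℝ} (hf : IntegrableOn f (unitCube n))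
    (hs : ∀ α : Fin n →₀ ℕ, s α = ∫ x in unitCube n, (∏ i, x i ^ α i) * f x)
    (p : MvPolynomial (Fin n) ℝ) :
    rieszFunctional s p = ∫ x in unitCube n, eval x p * f x := by
  have hint (p : MvPolynomial (Fin n) ℝ) : IntegrableOn (fun x => eval x p * f x) (unitCube n) :=
    hf.continuousOn_mul p.continuous_eval.continuousOn isCompact_unitCube
  let L : MvPolynomial (Fin n) ℝ →ₗ[ℝ] ℝ :=
    { toFun p := ∫ x in unitCube n, eval x p * f x
      map_add' p q := by
        simp only [map_add, add_mul]
        exact integral_add (hint p) (hint q)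
      map_smul' c p := by
        simp only [smul_eval, mul_assoc, integral_const_mul, smul_eq_mul, RingHom.id_apply] }
  have hL : L = rieszFunctional s := eq_rieszFunctional fun α => by
    simp [L, hs α, eval_monomial, Finsupp.prod_fintype]
  rw [← hL]
  rfl

end RieszFunctional

/-! ### From densities to Bernstein bounds -/

section Necessity

variable {n : ℕ} {s : (Fin n →₀ ℕ) → ℝ} {f : (Fin n → ℝ) → ℝ}

/-- The measure on the unit cube whose density is the positive part of `f`. -/
noncomputable def cubeDensity (f : (Fin n → ℝ) → ℝ) : Measure (Fin n → ℝ) :=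
  (volume.restrict (unitCube n)).withDensity fun x => ENNReal.ofReal (f x)

theorem isFiniteMeasure_cubeDensity (hf : IntegrableOn f (unitCube n)) :
    IsFiniteMeasure (cubeDensity f) :=
  isFiniteMeasure_withDensity_ofReal hf.2

theorem cubeDensity_compl_unitCube (f : (Fin n → ℝ) → ℝ) : cubeDensity f (unitCube n)ᶜ = 0 :=
  withDensity_absolutelyContinuous _ _
    (by rw [Measure.restrict_apply measurableSet_unitCube.compl, compl_inter_self, measure_empty])

theorem integral_cubeDensity (hf : IntegrableOn f (unitCube n)) (g : (Fin n → ℝ) → ℝ) :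
    ∫ x, g x ∂cubeDensity f = ∫ x in unitCube n, g x * max (f x) 0 := by
  rw [cubeDensity, integral_withDensity_eq_integral_toReal_smul₀ hf.aemeasurable.ennreal_ofReal
    (Eventually.of_forall fun _ => ENNReal.ofReal_lt_top)]
  simp only [ENNReal.toReal_ofReal', smul_eq_mul, mul_comm]

theorem isRepresentedBy_cubeDensity (hf : IntegrableOn f (unitCube n))
    (hs : ∀ α : Fin n →₀ ℕ, s α = ∫ x in unitCube n, (∏ i, x i ^ α i) * f x) :
    IsRepresentedBy (rieszFunctional s) (cubeDensity f) (cubeDensity (-f)) := by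
  refine ⟨cubeDensity_compl_unitCube f, cubeDensity_compl_unitCube (-f), fun p => ?_⟩
  have hint {h : (Fin n → ℝ) → ℝ} (hh : IntegrableOn h (unitCube n)) :
      IntegrableOn (fun x => eval x p * max (h x) 0) (unitCube n) := by
    have hpos : IntegrableOn (fun x => max (h x) 0) (unitCube n) := hh.pos_part
    exact hpos.continuousOn_mul p.continuous_eval.continuousOn isCompact_unitCube
  rw [rieszFunctional_eq_setIntegral hf hs, integral_cubeDensity hf, integral_cubeDensity hf.neg,
    ← integral_sub (hint hf) (hint hf.neg)]
  simp only [← mul_sub, Pi.neg_apply, max_zero_sub_max_neg_zero_eq_self]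

theorem exists_testFunction_eventuallyEq {E : Type*} [NormedAddCommGroup E] [NormedSpace ℝ E]
    [FiniteDimensional ℝ E] {g : E → ℝ} (hg : ContDiff ℝ ∞ g) {K : Set E} (hK : IsCompact K) :
    ∃ φ : 𝓓((⊤ : TopologicalSpace.Opens E), ℝ), ∀ x ∈ K, φ =ᶠ[𝓝 x] g := by
  obtain ⟨R, hR⟩ := hK.isBounded.subset_ball_lt 0 0
  let χ : ContDiffBump (0 : E) := ⟨R, R + 1, hR.1, lt_add_one R⟩
  refine ⟨⟨fun x => χ x * g x, χ.contDiff.mul hg, χ.hasCompactSupport.mul_right,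
    fun _ _ => trivial⟩, fun x hx => ?_⟩
  filter_upwards [χ.eventuallyEq_one_of_mem_ball (hR.2 hx)] with y hy
  exact (congrArg (· * g y) hy).trans (one_mul _)

theorem MixedDerivIsSignedMeasure.exists_forall_contDiff (hf : MixedDerivIsSignedMeasure f) :
    ∃ μ ν : Measure (Fin n → ℝ), IsFiniteMeasure μ ∧ IsFiniteMeasure ν ∧
      μ (unitCube n)ᶜ = 0 ∧ ν (unitCube n)ᶜ = 0 ∧
      ∀ g : (Fin n → ℝ) → ℝ, ContDiff ℝ ∞ g →
        (-1) ^ n * ∫ x in unitCube n, f x * mixedDeriv g x = (∫ x, g x ∂μ) - ∫ x, g x ∂ν := by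
  obtain ⟨μ, ν, hμfin, hνfin, -, -, hμ, hν, hφ⟩ := hf
  refine ⟨μ, ν, hμfin, hνfin, hμ, hν, fun g hg => ?_⟩
  obtain ⟨φ, hφg⟩ := exists_testFunction_eventuallyEq hg (isCompact_unitCube (n := n))
  have hint {ρ : Measure (Fin n → ℝ)} (hρ : ρ (unitCube n)ᶜ = 0) : ∫ x, φ x ∂ρ = ∫ x, g x ∂ρ :=
    integral_congr_ae (mem_of_superset (mem_ae_iff.2 hρ) fun x hx => (hφg x hx).eq_of_nhds)
  rw [← hint hμ, ← hint hν, ← hφ φ]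
  congr 1
  refine setIntegral_congr_fun measurableSet_unitCube fun x hx => ?_
  simp only [iteratedLineDerivOp_eq_iteratedFDeriv, mixedDeriv,
    ((hφg x hx).iteratedFDeriv ℝ n).eq_of_nhds]

theorem exists_isRepresentedBy_mixedDerivSeq (hf : IsRegularDensity s f) :
    ∃ μ ν : Measure (Fin n → ℝ), IsFiniteMeasure μ ∧ IsFiniteMeasure ν ∧
      IsRepresentedBy (rieszFunctional (mixedDerivSeq s)) μ ν := by
  obtain ⟨μ, ν, hμfin, hνfin, hμ, hν, h⟩ := hf.mixedDeriv.exists_forall_contDiff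
  refine ⟨μ, ν, hμfin, hνfin, hμ, hν, fun p => ?_⟩
  rw [← h _ (contDiff_eval p), mixedDeriv_eval, rieszFunctional_mixedDerivSeq,
    rieszFunctional_eq_setIntegral hf.integrableOn hf.moments]
  simp only [mul_comm]

theorem IsRegularDensity.exists_bernsteinSum_lt (hf : IsRegularDensity s f) :
    ∃ C : ℝ, 0 < C ∧ ∀ d : Fin n → ℕ,
      bernsteinSum s d < C ∧ bernsteinSum (mixedDerivSeq s) d < C := by
  obtain ⟨μ, ν, _, _, hμν⟩ := exists_isRepresentedBy_mixedDerivSeq hf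
  have hs := isRepresentedBy_cubeDensity hf.integrableOn hf.moments
  have := isFiniteMeasure_cubeDensity hf.integrableOn
  have := isFiniteMeasure_cubeDensity hf.integrableOn.neg
  set A : ℝ := (cubeDensity f).real univ + (cubeDensity (-f)).real univ
  set B : ℝ := μ.real univ + ν.real univ
  have hA : 0 ≤ A := by positivity
  have hB : 0 ≤ B := by positivity
  exact ⟨A + B + 1, by positivity, fun d =>
    ⟨by linarith [hs.bernsteinSum_le d], by linarith [hμν.bernsteinSum_le d]⟩⟩

end Necessity

/-! ### Distribution functions -/

section DistributionFunction

theorem ae_ae_forall_ne {ι : Type*} [Fintype ι] (μ : Measure (ι → ℝ)) [SFinite μ] :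
    ∀ᵐ y : ι → ℝ, ∀ᵐ a ∂μ, ∀ i, a i ≠ y i := by
  have hmeas : MeasurableSet {z : (ι → ℝ) × (ι → ℝ) | ∀ i, z.1 i ≠ z.2 i} := by
    rw [ofPred_forall]
    exact MeasurableSet.iInter fun i =>
      (measurableSet_eq_fun (f := fun z : (ι → ℝ) × (ι → ℝ) => z.1 i) (g := fun z => z.2 i)
        (by fun_prop) (by fun_prop)).compl
  refine (Measure.ae_ae_comm hmeas).1 (Eventually.of_forall fun a => ae_all_iff.2 fun i => ?_)
  have hplane : volume {y : ι → ℝ | y i = a i} = 0 := by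
    rw [volume_pi]
    exact Measure.pi_hyperplane (α := fun _ => ℝ) (fun _ => volume) i (a i)
  filter_upwards [mem_ae_iff.2 (by rwa [compl_compl])] with y hy using Ne.symm hy

theorem eventually_le_iff_of_forall_ne {ι : Type*} [Finite ι] {a y : ι → ℝ}
    (h : ∀ i, a i ≠ y i) : ∀ᶠ z in 𝓝 y, a ≤ z ↔ a ≤ y := by
  have hi (i) : ∀ᶠ z in 𝓝 y, a i ≤ z i ↔ a i ≤ y i := by
    have hcont : ContinuousAt (fun z : ι → ℝ => z i) y := (continuous_apply i).continuousAt
    rcases (h i).lt_or_gt with hlt | hgt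
    · filter_upwards [hcont.eventually_const_lt hlt] with z hz
      exact iff_of_true hz.le hlt.le
    · filter_upwards [hcont.eventually_lt_const hgt] with z hz
      exact iff_of_false hz.not_ge hgt.not_ge
  filter_upwards [eventually_all.2 hi] with z hz using forall_congr' hz

theorem ae_continuousAt_measureReal_Iic {ι : Type*} [Fintype ι] (μ : Measure (ι → ℝ))
    [IsFiniteMeasure μ] : ∀ᵐ y : ι → ℝ, ContinuousAt (fun y => μ.real (Iic y)) y := by
  filter_upwards [ae_ae_forall_ne μ] with y hy
  refine (ENNReal.tendsto_toReal (measure_ne_top μ _)).comp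
    (tendsto_measure_of_ae_tendsto_indicator_of_isFiniteMeasure (𝓝 y) measurableSet_Iic
      (fun _ => measurableSet_Iic) ?_)
  filter_upwards [hy] with a ha using eventually_le_iff_of_forall_ne ha

section Fubini

variable {E : Type*} [TopologicalSpace E] [PartialOrder E] [OrderClosedTopology E]
  [MeasurableSpace E] [OpensMeasurableSpace E] {μ ρ : Measure E} {h : E → ℝ}

theorem integral_indicator_Iic_mul (y : E) :
    ∫ a, (Iic y).indicator 1 a * h y ∂μ = μ.real (Iic y) * h y := by
  rw [integral_mul_const, integral_indicator_one measurableSet_Iic]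

variable [SecondCountableTopology E] [IsFiniteMeasure μ]

theorem integrable_indicator_Iic_mul (hh : Integrable h ρ) :
    Integrable (fun z : E × E => (Iic z.1).indicator 1 z.2 * h z.1) (ρ.prod μ) := by
  have hmeas : MeasurableSet {z : E × E | z.2 ≤ z.1} :=
    (isClosed_le continuous_snd continuous_fst).measurableSet
  refine ((hh.comp_fst μ).indicator hmeas).congr (Eventually.of_forall fun z => ?_)
  by_cases hz : z.2 ≤ z.1 <;> simp [Set.indicator, hz]

theorem integrable_measureReal_Iic_mul [SFinite ρ] (hh : Integrable h ρ) :
    Integrable (fun y => μ.real (Iic y) * h y) ρ :=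
  (integrable_indicator_Iic_mul (μ := μ) hh).integral_prod_left.congr
    (Eventually.of_forall fun y => integral_indicator_Iic_mul y)

theorem integral_measureReal_Iic_mul [SFinite ρ] (hh : Integrable h ρ) :
    ∫ y, μ.real (Iic y) * h y ∂ρ = ∫ a, ∫ y in Ici a, h y ∂ρ ∂μ := by
  simp only [← integral_indicator_Iic_mul]
  rw [integral_integral_swap (integrable_indicator_Iic_mul hh)]
  refine integral_congr_ae (Eventually.of_forall fun a => ?_)
  simp only [← integral_indicator (measurableSet_Ici (a := a))]
  refine integral_congr_ae (Eventually.of_forall fun y => ?_)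
  by_cases hy : a ≤ y <;> simp [Set.indicator, hy]

end Fubini

variable {n : ℕ} {μ : Measure (Fin n → ℝ)} [IsFiniteMeasure μ] {g : (Fin n → ℝ) → ℝ}

theorem boxVertex_mem_unitCube {a : Fin n → ℝ} (ha : a ∈ unitCube n) (ε : Fin n → Bool) :
    boxVertex a 1 ε ∈ unitCube n := by
  refine ⟨fun i => ?_, fun i => ?_⟩ <;> by_cases hi : ε i
  · simp [boxVertex, hi]
  · simpa [boxVertex, hi] using ha.1 i
  · simp [boxVertex, hi]
  · simpa [boxVertex, hi] using ha.2 i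

theorem continuous_boxVertex_one (ε : Fin n → Bool) :
    Continuous fun a : Fin n → ℝ => boxVertex a 1 ε :=
  continuous_pi fun i => by unfold boxVertex; split_ifs <;> fun_prop

theorem integrableOn_unitCube (hg : Continuous g) : IntegrableOn g (unitCube n) :=
  hg.continuousOn.integrableOn_compact isCompact_unitCube

theorem setIntegral_measureReal_Iic_mul_mixedDeriv (hμ : μ (unitCube n)ᶜ = 0)
    (hg : ContDiff ℝ n g) :
    ∫ y in unitCube n, μ.real (Iic y) * mixedDeriv g y =
      ∑ ε, vertexSign ε * ∫ a, g (boxVertex a 1 ε) ∂μ := by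
  have hinter {a : Fin n → ℝ} (ha : a ∈ unitCube n) : Ici a ∩ unitCube n = Icc a 1 := by
    ext y
    exact ⟨fun hy => ⟨hy.1, hy.2.2⟩, fun hy => ⟨hy.1, ha.1.trans hy.1, hy.2⟩⟩
  have hint (ε : Fin n → Bool) : Integrable (fun a => vertexSign ε * g (boxVertex a 1 ε)) μ :=
    (integrable_of_continuous_of_measure_compl_eq_zero isCompact_unitCube hμ
      (hg.continuous.comp (continuous_boxVertex_one ε))).const_mul _
  rw [integral_measureReal_Iic_mul (integrableOn_unitCube (continuous_mixedDeriv hg))]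
  calc ∫ a, ∫ y in Ici a, mixedDeriv g y ∂(volume.restrict (unitCube n)) ∂μ
      = ∫ a, ∑ ε, vertexSign ε * g (boxVertex a 1 ε) ∂μ := by
        refine integral_congr_ae ?_
        filter_upwards [mem_ae_iff.2 hμ] with a ha
        rw [Measure.restrict_restrict measurableSet_Ici, hinter ha,
          setIntegral_Icc_mixedDeriv hg ha.2]
    _ = ∑ ε, vertexSign ε * ∫ a, g (boxVertex a 1 ε) ∂μ := by
        rw [integral_finsetSum _ fun ε _ => hint ε]
        simp only [integral_const_mul]

theorem setIntegral_measureReal_Iic_mul_mixedDeriv_of_eq_zero (hμ : μ (unitCube n)ᶜ = 0)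
    (hg : ContDiff ℝ n g) (hzero : ∀ x i, x i = 1 → g x = 0) :
    ∫ y in unitCube n, μ.real (Iic y) * mixedDeriv g y = (-1) ^ n * ∫ a, g a ∂μ := by
  rw [setIntegral_measureReal_Iic_mul_mixedDeriv hμ hg, Fintype.sum_eq_single fun _ => false]
  · have hvertex (a : Fin n → ℝ) : boxVertex a 1 (fun _ => false) = a := by ext; simp [boxVertex]
    simp [vertexSign, hvertex]
  · intro ε hε
    obtain ⟨i, hi⟩ := Function.ne_iff.1 hε
    have hvanish (a : Fin n → ℝ) : g (boxVertex a 1 ε) = 0 :=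
      hzero _ i (by simp [boxVertex, Bool.eq_true_of_not_eq_false hi])
    simp only [hvanish, integral_zero, mul_zero]

theorem tendsto_setIntegral_measureReal_Iic_mul_mixedDeriv (hμ : μ (unitCube n)ᶜ = 0)
    {G : ℕ → (Fin n → ℝ) → ℝ} (hG : ∀ k, ContDiff ℝ n (G k)) (hg : ContDiff ℝ n g)
    (hlim : TendstoUniformlyOn G g atTop (unitCube n)) :
    Tendsto (fun k => ∫ y in unitCube n, μ.real (Iic y) * mixedDeriv (G k) y) atTop
      (𝓝 (∫ y in unitCube n, μ.real (Iic y) * mixedDeriv g y)) := by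
  simp only [setIntegral_measureReal_Iic_mul_mixedDeriv hμ (hG _),
    setIntegral_measureReal_Iic_mul_mixedDeriv hμ hg]
  refine tendsto_finsetSum _ fun ε _ => Tendsto.const_mul _ ?_
  exact tendsto_integral_of_tendstoUniformlyOn isCompact_unitCube hμ
    (fun k => (hG k).continuous.comp (continuous_boxVertex_one ε))
    (hg.continuous.comp (continuous_boxVertex_one ε))
    ((hlim.comp fun a => boxVertex a 1 ε).mono fun a ha => boxVertex_mem_unitCube ha ε)

end DistributionFunction

section Antiderivative

theorem derivation_prod {ι R A M : Type*} [DecidableEq ι] [CommSemiring R] [CommSemiring A]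
    [Algebra R A] [AddCommMonoid M] [Module A M] [Module R M] (D : Derivation R A M)
    (t : Finset ι) (f : ι → A) : D (∏ i ∈ t, f i) = ∑ i ∈ t, (∏ j ∈ t.erase i, f j) • D (f i) := by
  induction t using Finset.induction_on with
  | empty => simp
  | insert i t hi ih =>
    rw [Finset.prod_insert hi, D.leibniz, ih, Finset.sum_insert hi, Finset.erase_insert hi,
      add_comm, Finset.smul_sum]
    congr 1
    refine Finset.sum_congr rfl fun j hj => ?_
    rw [Finset.erase_insert_of_ne (ne_of_mem_of_not_mem hj hi).symm,
      Finset.prod_insert (fun h => hi (Finset.mem_of_mem_erase h)), mul_smul]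

variable {n : ℕ}

theorem pderiv_prod_aeval_X (j : Fin n) (f : Fin n → Polynomial ℝ) :
    pderiv j (∏ i, Polynomial.aeval (X i : MvPolynomial (Fin n) ℝ) (f i)) =
      ∏ i, Polynomial.aeval (X i) (if i = j then (f i).derivative else f i) := by
  have hD (i) : pderiv j (Polynomial.aeval (X i : MvPolynomial (Fin n) ℝ) (f i)) =
      if i = j then Polynomial.aeval (X i) (f i).derivative else 0 := by
    rw [Derivation.comp_aeval_eq, pderiv_X]
    by_cases hij : i = j <;> simp [hij]
  rw [derivation_prod, Fintype.sum_eq_single j fun i hij => by simp [hD, hij], hD, if_pos rfl,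
    smul_eq_mul, ← Finset.prod_erase_mul _ _ (Finset.mem_univ j), if_pos rfl]
  congr 1
  exact Finset.prod_congr rfl fun i hi => by rw [if_neg (Finset.ne_of_mem_erase hi)]

theorem mixedPartial_prod_aeval_X (f : Fin n → Polynomial ℝ) :
    mixedPartial (∏ i, Polynomial.aeval (X i : MvPolynomial (Fin n) ℝ) (f i)) =
      ∏ i, Polynomial.aeval (X i) (f i).derivative := by
  have hfoldr (l : List (Fin n)) (hl : l.Nodup) :
      l.foldr (fun i q => pderiv i q)
          (∏ i, Polynomial.aeval (X i : MvPolynomial (Fin n) ℝ) (f i)) =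
        ∏ i, Polynomial.aeval (X i) (if i ∈ l then (f i).derivative else f i) := by
    induction l with
    | nil => simp
    | cons j l ih =>
      rw [List.nodup_cons] at hl
      rw [List.foldr_cons, ih hl.2, pderiv_prod_aeval_X]
      refine Finset.prod_congr rfl fun i _ => ?_
      by_cases hij : i = j
      · simp [hij, hl.1]
      · simp [hij]
  simp [mixedPartial, hfoldr _ (List.nodup_finRange n)]

theorem exists_mixedPartial_eq_monomial (α : Fin n →₀ ℕ) :
    ∃ P : MvPolynomial (Fin n) ℝ, mixedPartial P = monomial α 1 ∧
      ∀ x i, x i = 1 → eval x P = 0 := by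
  let f (i : Fin n) : Polynomial ℝ :=
    Polynomial.C ((α i + 1 : ℝ)⁻¹) * (Polynomial.X ^ (α i + 1) - 1)
  refine ⟨∏ i, Polynomial.aeval (X i) (f i), ?_, fun x i hi => ?_⟩
  · have hderiv (i) : (f i).derivative = Polynomial.X ^ α i := by
      have hne : (α i + 1 : ℝ) ≠ 0 := by positivity
      simp only [f, Polynomial.derivative_C_mul, Polynomial.derivative_sub,
        Polynomial.derivative_X_pow, Polynomial.derivative_one, sub_zero, Nat.cast_succ,
        Nat.succ_sub_one, ← mul_assoc, ← Polynomial.C_mul, inv_mul_cancel₀ hne, map_one, one_mul]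
    simp [mixedPartial_prod_aeval_X, hderiv, monomial_eq, Finsupp.prod_fintype]
  · rw [map_prod]
    exact Finset.prod_eq_zero (Finset.mem_univ i) (by simp [f, hi])

end Antiderivative

section Sufficiency

variable {n : ℕ} {s : (Fin n →₀ ℕ) → ℝ} {μ ν : Measure (Fin n → ℝ)} [IsFiniteMeasure μ]
  [IsFiniteMeasure ν]

/-- The distribution function `y ↦ (μ - ν) {a | a ≤ y}` of the signed measure `μ - ν`. -/
def distributionFunction (μ ν : Measure (Fin n → ℝ)) (y : Fin n → ℝ) : ℝ :=
  μ.real (Iic y) - ν.real (Iic y)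

theorem setIntegral_distributionFunction_mul {h : (Fin n → ℝ) → ℝ} (hh : Continuous h) :
    ∫ y in unitCube n, distributionFunction μ ν y * h y =
      (∫ y in unitCube n, μ.real (Iic y) * h y) - ∫ y in unitCube n, ν.real (Iic y) * h y := by
  simp only [distributionFunction, sub_mul]
  exact integral_sub (integrable_measureReal_Iic_mul (integrableOn_unitCube hh))
    (integrable_measureReal_Iic_mul (integrableOn_unitCube hh))

theorem integrableOn_distributionFunction :
    IntegrableOn (distributionFunction μ ν) (unitCube n) := by
  have hone : IntegrableOn (fun _ => (1 : ℝ)) (unitCube n) :=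
    integrableOn_unitCube continuous_const
  have hμν := (integrable_measureReal_Iic_mul (μ := μ) hone).sub
    (integrable_measureReal_Iic_mul (μ := ν) hone)
  simp only [mul_one] at hμν
  exact hμν

theorem moment_distributionFunction
    (h : IsRepresentedBy (rieszFunctional (mixedDerivSeq s)) μ ν) (α : Fin n →₀ ℕ) :
    s α = ∫ y in unitCube n, (∏ i, y i ^ α i) * distributionFunction μ ν y := by
  obtain ⟨P, hP, hzero⟩ := exists_mixedPartial_eq_monomial α
  have hmixed : (mixedDeriv fun x => eval x P) = fun y => ∏ i, y i ^ α i := by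
    ext y
    simp [mixedDeriv_eval, hP, eval_monomial, Finsupp.prod_fintype]
  have hsign : (-1 : ℝ) ^ n * (-1) ^ n = 1 := by simp [← mul_pow]
  have hμν := rieszFunctional_mixedDerivSeq s P
  rw [hP, rieszFunctional_monomial, h.apply_eq] at hμν
  calc s α = (-1) ^ n * ((∫ x, eval x P ∂μ) - ∫ x, eval x P ∂ν) := by
        rw [hμν, ← mul_assoc, hsign, one_mul]
    _ = ∫ y in unitCube n, distributionFunction μ ν y * mixedDeriv (fun x => eval x P) y := by
        rw [setIntegral_distributionFunction_mul (continuous_mixedDeriv (contDiff_eval P)),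
          setIntegral_measureReal_Iic_mul_mixedDeriv_of_eq_zero h.left_compl (contDiff_eval P)
            hzero,
          setIntegral_measureReal_Iic_mul_mixedDeriv_of_eq_zero h.right_compl (contDiff_eval P)
            hzero, mul_sub]
    _ = _ := by simp only [hmixed, mul_comm]

theorem setIntegral_distributionFunction_mul_mixedDeriv
    (h : IsRepresentedBy (rieszFunctional (mixedDerivSeq s)) μ ν) {g : (Fin n → ℝ) → ℝ}
    (hg : ContDiff ℝ n g) :
    (-1) ^ n * ∫ y in unitCube n, distributionFunction μ ν y * mixedDeriv g y =
      (∫ x, g x ∂μ) - ∫ x, g x ∂ν := by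
  have hpoly (p : MvPolynomial (Fin n) ℝ) :
      (-1) ^ n * ∫ y in unitCube n, distributionFunction μ ν y * mixedDeriv (fun x => eval x p) y =
        (∫ x, eval x p ∂μ) - ∫ x, eval x p ∂ν := by
    rw [← h.apply_eq, rieszFunctional_mixedDerivSeq, mixedDeriv_eval, rieszFunctional_eq_setIntegral
      integrableOn_distributionFunction (moment_distributionFunction h)]
    simp only [mul_comm]
  obtain ⟨p, hp⟩ := exists_tendstoUniformlyOn_eval isCompact_unitCube hg.continuous
  have hlim {ρ : Measure (Fin n → ℝ)} [IsFiniteMeasure ρ] (hρ : ρ (unitCube n)ᶜ = 0) :=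
    tendsto_integral_of_tendstoUniformlyOn isCompact_unitCube hρ
      (fun k => (p k).continuous_eval) hg.continuous hp
  have hlim' {ρ : Measure (Fin n → ℝ)} [IsFiniteMeasure ρ] (hρ : ρ (unitCube n)ᶜ = 0) :=
    tendsto_setIntegral_measureReal_Iic_mul_mixedDeriv hρ (fun k => contDiff_eval (p k)) hg hp
  refine tendsto_nhds_unique ?_ ((hlim h.left_compl).sub (hlim h.right_compl))
  simp only [← hpoly, setIntegral_distributionFunction_mul (continuous_mixedDeriv hg),
    setIntegral_distributionFunction_mul (continuous_mixedDeriv (contDiff_eval _))]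
  exact ((hlim' h.left_compl).sub (hlim' h.right_compl)).const_mul _

theorem isRegularDensity_distributionFunction
    (h : IsRepresentedBy (rieszFunctional (mixedDerivSeq s)) μ ν) :
    IsRegularDensity s (distributionFunction μ ν) where
  ae_continuous := by
    refine ae_restrict_of_ae ?_
    filter_upwards [ae_continuousAt_measureReal_Iic μ, ae_continuousAt_measureReal_Iic ν]
      with y hμ hν
    exact (hμ.sub hν).continuousWithinAt
  integrableOn := integrableOn_distributionFunction
  moments := moment_distributionFunction h
  mixedDeriv := by
    refine ⟨μ, ν, inferInstance, inferInstance, inferInstance, inferInstance, h.left_compl,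
      h.right_compl, fun φ => ?_⟩
    rw [iteratedLineDerivOp_eq_iteratedFDeriv]
    exact setIntegral_distributionFunction_mul_mixedDeriv h
      (φ.contDiff.of_le (by exact_mod_cast le_top))

theorem exists_isRegularDensity_of_bernsteinSum_le {C : ℝ}
    (hC : ∀ N : ℕ, bernsteinSum (mixedDerivSeq s) (fun _ => N) ≤ C) :
    ∃ f, IsRegularDensity s f := by
  obtain ⟨μ, ν, _, _, hμν⟩ := exists_isRepresentedBy_of_sum_abs_le fun N =>
    (sum_abs_bernsteinBasis_eq_bernsteinSum (mixedDerivSeq s) N).trans_le (hC N)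
  exact ⟨_, isRegularDensity_distributionFunction hμν⟩

end Sufficiency

/-! ### Positivity -/

section Positivity

variable {n : ℕ} {s : (Fin n →₀ ℕ) → ℝ} {f : (Fin n → ℝ) → ℝ}

theorem cubeDensity_neg_le (hf : IntegrableOn f (unitCube n))
    (hs : ∀ α : Fin n →₀ ℕ, s α = ∫ x in unitCube n, (∏ i, x i ^ α i) * f x)
    (hpos : ∀ k l : Fin n → ℕ, 0 ≤ rieszFunctional s (bernsteinProd k l)) :
    cubeDensity (-f) ≤ cubeDensity f := by
  obtain ⟨μ, _, hμ⟩ := exists_isRepresentedBy_of_bernsteinProd_nonneg hpos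
  have hrep := isRepresentedBy_cubeDensity hf hs
  have := isFiniteMeasure_cubeDensity hf
  have := isFiniteMeasure_cubeDensity hf.neg
  have hcompl : (μ + cubeDensity (-f)) (unitCube n)ᶜ = 0 := by
    simp [hμ.left_compl, cubeDensity_compl_unitCube]
  have hadd : cubeDensity f = μ + cubeDensity (-f) := by
    refine measure_ext_of_integral_eval_eq isCompact_unitCube hrep.left_compl hcompl fun p => ?_
    have hp := (hrep.apply_eq p).symm.trans (hμ.apply_eq p)
    rw [integral_zero_measure, sub_zero] at hp
    rw [integral_add_measure (integrable_eval hμ.left_compl p)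
      (integrable_eval hrep.right_compl p), ← hp, sub_add_cancel]
  exact hadd ▸ Measure.le_add_left le_rfl

theorem ae_nonneg_of_bernsteinProd_nonneg (hf : IntegrableOn f (unitCube n))
    (hs : ∀ α : Fin n →₀ ℕ, s α = ∫ x in unitCube n, (∏ i, x i ^ α i) * f x)
    (hpos : ∀ k l : Fin n → ℕ, 0 ≤ rieszFunctional s (bernsteinProd k l)) :
    ∀ᵐ x ∂volume.restrict (unitCube n), 0 ≤ f x := by
  have hle : (fun x => ENNReal.ofReal (-f x)) ≤ᵐ[volume.restrict (unitCube n)]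
      fun x => ENNReal.ofReal (f x) := by
    refine ae_le_of_forall_setLIntegral_le_of_sigmaFinite₀ hf.aemeasurable.neg.ennreal_ofReal
      fun A hA _ => ?_
    rw [← withDensity_apply _ hA, ← withDensity_apply _ hA]
    exact cubeDensity_neg_le hf hs hpos A
  filter_upwards [hle] with x hx
  by_contra! hneg
  exact absurd hx (by simp [ENNReal.ofReal_of_nonpos hneg.le, hneg])

theorem nonneg_of_ae_nonneg_of_continuousWithinAt {E : Type*} [TopologicalSpace E]
    [MeasurableSpace E] {ρ : Measure E} [ρ.IsOpenPosMeasure] {K : Set E} {f : E → ℝ}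
    (hf : ∀ᵐ x ∂ρ.restrict K, 0 ≤ f x) {x : E} (hx : x ∈ closure (interior K))
    (hcont : ContinuousWithinAt f K x) : 0 ≤ f x := by
  by_contra! hneg
  obtain ⟨U, hU, hxU, hUf⟩ := mem_nhdsWithin.1 (hcont.eventually_lt_const hneg)
  have hpos : 0 < ρ (U ∩ interior K) :=
    (hU.inter isOpen_interior).measure_pos ρ (mem_closure_iff.1 hx U hU hxU)
  refine hpos.ne' ?_
  rw [← Measure.restrict_eq_self ρ (inter_subset_right.trans interior_subset)]
  refine measure_mono_null (fun y hy => ?_) (mem_ae_iff.1 hf)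
  exact not_le.2 (show f y < 0 from hUf ⟨hy.1, interior_subset hy.2⟩)

theorem unitCube_subset_closure_interior : unitCube n ⊆ closure (interior (unitCube n)) := by
  rw [unitCube, ← pi_univ_Icc, interior_pi_set finite_univ, closure_pi_set]
  exact pi_mono fun i _ => (closure_interior_Icc zero_ne_one).ge

theorem IsRegularDensity.max_zero (hf : IsRegularDensity s f)
    (hnonneg : ∀ᵐ x ∂volume.restrict (unitCube n), 0 ≤ f x) :
    IsRegularDensity s fun x => max (f x) 0 := by
  have hae : f =ᵐ[volume.restrict (unitCube n)] fun x => max (f x) 0 :=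
    hnonneg.mono fun x hx => (max_eq_left hx).symm
  have hint (g : (Fin n → ℝ) → ℝ) :
      ∫ x in unitCube n, max (f x) 0 * g x = ∫ x in unitCube n, f x * g x :=
    integral_congr_ae (hae.symm.mul .rfl)
  refine ⟨hf.ae_continuous.mono fun x hx => hx.max continuousWithinAt_const,
    Integrable.congr hf.integrableOn hae, fun α => ?_, ?_⟩
  · simpa only [mul_comm, hint] using hf.moments α
  · simpa only [MixedDerivIsSignedMeasure, hint] using hf.mixedDeriv

end Positivity

end CubeMoment

theorem corollary3p4 (n : ℕ) (hn : 1 ≤ n) (s : (Fin n →₀ ℕ) → ℝ) :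
    ((∃ f : (Fin n → ℝ) → ℝ, CubeMoment.IsRegularDensity s f) ↔
      ∃ C : ℝ, 0 < C ∧ ∀ d : Fin n → ℕ,
        CubeMoment.bernsteinSum s d < C ∧
        CubeMoment.bernsteinSum (CubeMoment.mixedDerivSeq s) d < C) ∧
    ((∀ k l : Fin n → ℕ, 0 ≤ CubeMoment.rieszFunctional s (CubeMoment.bernsteinProd k l)) →
      (∀ f : (Fin n → ℝ) → ℝ, CubeMoment.IsRegularDensity s f →
        (∀ᵐ x ∂(volume.restrict (CubeMoment.unitCube n)), 0 ≤ f x) ∧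
        (∀ x ∈ CubeMoment.unitCube n,
          ContinuousWithinAt f (CubeMoment.unitCube n) x → 0 ≤ f x)) ∧
      ((∃ f : (Fin n → ℝ) → ℝ, CubeMoment.IsRegularDensity s f) →
        ∃ f : (Fin n → ℝ) → ℝ, CubeMoment.IsRegularDensity s f ∧
          ∀ x ∈ CubeMoment.unitCube n, 0 ≤ f x)) := by
  refine ⟨⟨fun ⟨_, hf⟩ => hf.exists_bernsteinSum_lt, fun ⟨_, _, hC⟩ =>
    CubeMoment.exists_isRegularDensity_of_bernsteinSum_le fun _ => (hC _).2.le⟩,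
    fun hpos => ?_⟩
  have hae {f : (Fin n → ℝ) → ℝ} (hf : CubeMoment.IsRegularDensity s f) :
      ∀ᵐ x ∂volume.restrict (CubeMoment.unitCube n), 0 ≤ f x :=
    CubeMoment.ae_nonneg_of_bernsteinProd_nonneg hf.integrableOn hf.moments hpos
  refine ⟨fun f hf => ⟨hae hf, fun x hx hcont => ?_⟩, fun ⟨_, hf⟩ =>
    ⟨_, hf.max_zero (hae hf), fun _ _ => le_max_right _ _⟩⟩
  exact CubeMoment.nonneg_of_ae_nonneg_of_continuousWithinAt (hae hf)
    (CubeMoment.unitCube_subset_closure_interior hx) hcont
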